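/- Let $N\ge 0$. For a partition $\lambda=(\lambda_1\ge\dots\ge\lambda_N\ge 0)$ with at most $N$ parts and $\beta\in\mathbb C$, define rational functions in $z=(z_1,\dots,z_N)$ by $$G_\lambda(z;\beta)=\frac{\det\big(z_j^{\lambda_k+N-k}(1+\beta z_j)^{k-1}\big)_{j,k=1}^N}{\prod_{1\le j<k\le N}(z_j-z_k)},\qquad \overline G_\lambda(z;\beta)=\frac{\det\big(z_j^{\lambda_k+N-k}(1+\beta z_j^{-1})^{1-k}\big)_{j,k=1}^N}{\prod_{1\le j<k\le N}(z_j-z_k)},$$ and let $s_\lambda(z)=\det\big(z_j^{\lambda_k+N-k}\big)_{j,k=1}^N\big/\prod_{1\le j<k\le N}(z_j-z_k)$ be the Schur polynomial. The values of these functions at points with coinciding coordinates are the values of the reduced fractions. (i) Let $\beta\in\mathbb C$ and $z,y\in\mathbb C^N$ with $y_j\ne 0$ and $1+\beta y_j^{-1}\ne 0$ for all $j$, and $|z_jy_k|<1$ for all $j,k$. Then $$\sum_{\lambda}G_\lambda(z;\beta)\,\overline G_\lambda(y;\beta)=\prod_{j=1}^N\left(\frac{1+\beta z_j}{1+\beta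 y_j^{-1}}\right)^{N-1}\prod_{j,k=1}^N\frac{1}{1-z_jy_k},$$ where the sum is over all partitions with at most $N$ parts and converges absolutely. (ii) At $\beta=0$ the classical Cauchy identity is recovered: $G_\lambda(z;0)=\overline G_\lambda(z;0)=s_\lambda(z)$ for every $\lambda$, and for all $z,y\in\mathbb C^N$ with $|z_jy_k|<1$ for all $j,k$, $$\sum_{\lambda}s_\lambda(z)\,s_\lambda(y)=\prod_{j,k=1}^N\frac{1}{1-z_jy_k},$$ again with absolute convergence. -/

import Mathlib

noncomputable section

/-- The field `ℂ(z_1, …, z_N)` of rational functions in `N` complex variables. -/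
abbrev RatField (N : ℕ) : Type := FractionRing (MvPolynomial (Fin N) ℂ)

/-- The variable `z_j`, as an element of `ℂ(z_1, …, z_N)`. -/
def ratVar {N : ℕ} (j : Fin N) : RatField N :=
  algebraMap (MvPolynomial (Fin N) ℂ) (RatField N) (MvPolynomial.X j)

/-- The complex constant `c`, as an element of `ℂ(z_1, …, z_N)`. -/
def ratConst {N : ℕ} (c : ℂ) : RatField N :=
  algebraMap (MvPolynomial (Fin N) ℂ) (RatField N) (MvPolynomial.C c)

/-- The value of a rational function at a point, computed from its reduced fraction. It is the
value `p(a) / q(a)` for every representation `p / q` with `q(a) ≠ 0`, see `ratEval_div`. -/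
def ratEval {N : ℕ} (a : Fin N → ℂ) (r : RatField N) : ℂ :=
  MvPolynomial.eval a (IsFractionRing.num (MvPolynomial (Fin N) ℂ) r) /
    MvPolynomial.eval a (IsFractionRing.den (MvPolynomial (Fin N) ℂ) r : MvPolynomial (Fin N) ℂ)

theorem ratEval_div {N : ℕ} (a : Fin N → ℂ) (p q : MvPolynomial (Fin N) ℂ)
    (hq : MvPolynomial.eval a q ≠ 0) :
    ratEval a (algebraMap _ (RatField N) p / algebraMap _ (RatField N) q) =
      MvPolynomial.eval a p / MvPolynomial.eval a q := by
  set r : RatField N := algebraMap _ (RatField N) p / algebraMap _ (RatField N) q with hr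
  have hq0 : q ≠ 0 := by rintro rfl; simp at hq
  have hinj := IsFractionRing.injective (MvPolynomial (Fin N) ℂ) (RatField N)
  have hq' : algebraMap _ (RatField N) q ≠ 0 := by
    rwa [Ne, map_eq_zero_iff _ hinj]
  set n := IsFractionRing.num (MvPolynomial (Fin N) ℂ) r with hn
  set d := (IsFractionRing.den (MvPolynomial (Fin N) ℂ) r : MvPolynomial (Fin N) ℂ) with hd
  have hd0 : d ≠ 0 := nonZeroDivisors.ne_zero (IsFractionRing.den _ r).2
  have hd' : algebraMap _ (RatField N) d ≠ 0 := by
    rwa [Ne, map_eq_zero_iff _ hinj]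
  have h1 : algebraMap _ (RatField N) n / algebraMap _ (RatField N) d = r :=
    IsFractionRing.mk'_num_den' _ r
  have h2 : n * q = p * d := by
    apply hinj
    rw [map_mul, map_mul]
    rw [hr, div_eq_div_iff hd' hq'] at h1
    exact h1
  have h3 : d ∣ q := by
    have hrel : IsRelPrime n d := IsFractionRing.num_den_reduced _ r
    exact hrel.symm.dvd_of_dvd_mul_left ⟨p, by rw [h2]; ring⟩
  have h4 : MvPolynomial.eval a d ≠ 0 := by
    obtain ⟨c, hc⟩ := h3
    intro h
    apply hq
    rw [hc, map_mul, h, zero_mul]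
  change MvPolynomial.eval a n / MvPolynomial.eval a d = _
  rw [div_eq_div_iff h4 hq, ← map_mul, h2, map_mul]

/-- Young diagrams `λ = (λ_1 ≥ λ_2 ≥ ⋯ ≥ λ_N ≥ 0)`, that is, partitions with at most `N` parts.
The entry `l.1 k` is `λ_{k+1}`. -/
abbrev Partitions (N : ℕ) : Type := {l : Fin N → ℕ // Antitone l}

/-- `∏_{1 ≤ j < k ≤ N} (z_j - z_k)`. -/
def vandermondeProd (N : ℕ) : RatField N :=
  ∏ j : Fin N, ∏ k ∈ Finset.Ioi j, (ratVar j - ratVar k)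

/-- The Grothendieck polynomial
`G_λ(z; β) = det (z_j^{λ_k + N - k} (1 + β z_j)^{k - 1})_{j, k} / ∏_{j < k} (z_j - z_k)`.
The index `k : Fin N` stands for the column number `k + 1`. -/
def grothendieck {N : ℕ} (β : ℂ) (l : Partitions N) : RatField N :=
  (Matrix.of fun j k : Fin N =>
    ratVar j ^ (l.1 k + (N - 1 - (k : ℕ))) *
      (1 + ratConst β * ratVar j) ^ (k : ℕ)).det / vandermondeProd N

/-- The dual Grothendieck polynomial
`det (z_j^{λ_k + N - k} (1 + β z_j⁻¹)^{1 - k})_{j, k} / ∏_{j < k} (z_j - z_k)`. -/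
def dualGrothendieck {N : ℕ} (β : ℂ) (l : Partitions N) : RatField N :=
  (Matrix.of fun j k : Fin N =>
    ratVar j ^ (l.1 k + (N - 1 - (k : ℕ))) *
      (1 + ratConst β * (ratVar j)⁻¹) ^ (-((k : ℕ) : ℤ))).det / vandermondeProd N

/-- The Schur polynomial `s_λ(z) = det (z_j^{λ_k + N - k})_{j, k} / ∏_{j < k} (z_j - z_k)`. -/
def schurPoly {N : ℕ} (l : Partitions N) : RatField N :=
  (Matrix.of fun j k : Fin N =>
    ratVar j ^ (l.1 k + (N - 1 - (k : ℕ)))).det / vandermondeProd N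

end

/-! Pair a polynomial with a power series by summing products of coefficients. The column functions
of the two Grothendieck families, with factors independent of the column removed, become the
polynomials `dualFamily` and the series `directFamily`. Their determinants of pairings are
biorthogonal (`det_coeffPairing_dualFamily`), so every determinant of values `p j (y k)` expands in
the dual family, with pairing determinants as coefficients (`det_eval_eq_sum`).

The expansion is applied to truncations of `(1 + β z_j)^(N-1) / (1 - z_j X)`. Pairing with this
kernel evaluates a series at `z_j`, and the factor `(1 + β z_j)^(N-1)` turns `directFamily` into the
columns of `G_λ`. Dominated convergence removes the truncation, and the left side becomes a Cauchy
determinant (`det_one_div_one_sub_mul`). Dividing by both Vandermonde determinants gives the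
identity at generic points.

At coinciding coordinates the quotients are determinants of divided differences (`newtonDet`). These
are polynomial in the coordinates, and the maximum principle bounds them uniformly near any point,
so a second dominated limit, along a perturbation, gives every point (`hasSum_newtonDet`). -/

/-! ### Biorthogonality of the direct and dual families -/

noncomputable section DualBases

open Polynomial

variable {R : Type*} [CommRing R] {N : ℕ}

/-- The pairing `∑ p_i s_i` of a polynomial `p` with a power series `s`. -/
def coeffPairing (s : PowerSeries R) : R[X] →ₗ[R] R :=
  Polynomial.lsum fun i => PowerSeries.coeff i s • LinearMap.id

theorem coeffPairing_monomial (s : PowerSeries R) (i : ℕ) (a : R) :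
    coeffPairing s (monomial i a) = a * PowerSeries.coeff i s := by
  simp [coeffPairing, Polynomial.lsum_apply, mul_comm]

theorem coeffPairing_eq_sum (s : PowerSeries R) (p : R[X]) :
    coeffPairing s p = ∑ i ∈ p.support, p.coeff i * PowerSeries.coeff i s := by
  simp [coeffPairing, Polynomial.lsum_apply, Polynomial.sum, mul_comm]

/-- Shifting both arguments by `X` does not change the pairing, and a constant moves freely from one
side to the other. -/
theorem coeffPairing_X_mul (β : R) (s : PowerSeries R) (p : R[X]) :
    coeffPairing (PowerSeries.X * s) ((X + C β) * p) =
      coeffPairing ((1 + PowerSeries.C β * PowerSeries.X) * s) p := by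
  induction p using Polynomial.induction_on' with
  | add p q hp hq => rw [mul_add, map_add, map_add, hp, hq]
  | monomial i a =>
    rw [add_mul, X_mul_monomial, C_mul_monomial, map_add]
    simp only [coeffPairing_monomial, PowerSeries.coeff_succ_X_mul, add_mul, one_mul, map_add,
      mul_assoc, PowerSeries.coeff_C_mul]
    ring

/-- The power series of `(1 + β X)⁻¹`. -/
def geomSeries (β : R) : PowerSeries R := PowerSeries.mk fun i => (-β) ^ i

theorem geomSeries_mul (β : R) :
    (1 + PowerSeries.C β * PowerSeries.X) * geomSeries β = 1 := by
  ext i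
  cases i with
  | zero => simp [geomSeries, add_mul, mul_assoc]
  | succ i =>
    simp [geomSeries, add_mul, mul_assoc, PowerSeries.coeff_succ_X_mul, PowerSeries.coeff_one]
    ring

/-- Each factor `X + β` of the polynomial cancels one factor `X / (1 + β X)` of the series; what
remains is the pairing with `X ^ a`. -/
theorem coeffPairing_geomSeries (β : R) (a n : ℕ) (p : R[X]) :
    coeffPairing (PowerSeries.X ^ (a + n) * geomSeries β ^ n) ((X + C β) ^ n * p) =
      p.coeff a := by
  induction n with
  | zero =>
    rw [coeffPairing_eq_sum]
    simp [PowerSeries.coeff_X_pow]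
    exact fun h => h.symm
  | succ n ih =>
    have h : (PowerSeries.X : PowerSeries R) ^ (a + (n + 1)) * geomSeries β ^ (n + 1) =
        PowerSeries.X * (PowerSeries.X ^ (a + n) * geomSeries β ^ n * geomSeries β) := by ring
    rw [h, pow_succ' (X + C β), mul_assoc (X + C β), coeffPairing_X_mul, mul_comm _ (geomSeries β),
      ← mul_assoc, geomSeries_mul, one_mul, ih]

/-- The polynomials `X ^ l_k (X + β) ^ (N - 1 - k)`, for `k < N`. -/
def dualFamily (β : R) (l : Fin N → ℕ) (k : Fin N) : R[X] :=
  X ^ l k * (X + C β) ^ (N - 1 - (k : ℕ))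

/-- The power series `X ^ (l_k + N - 1 - k) (1 + β X) ^ (k + 1 - N)`, for `k < N`. -/
def directFamily (β : R) (l : Fin N → ℕ) (k : Fin N) : PowerSeries R :=
  PowerSeries.X ^ (l k + (N - 1 - (k : ℕ))) * geomSeries β ^ (N - 1 - (k : ℕ))

theorem monic_dualFamily (β : R) (l : Fin N → ℕ) (k : Fin N) : (dualFamily β l k).Monic :=
  (monic_X_pow _).mul ((monic_X_add_C β).pow _)

theorem natDegree_dualFamily [Nontrivial R] (β : R) (l : Fin N → ℕ) (k : Fin N) :
    (dualFamily β l k).natDegree = l k + (N - 1 - (k : ℕ)) := by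
  rw [dualFamily, (monic_X_pow _).natDegree_mul ((monic_X_add_C β).pow _), natDegree_X_pow,
    (monic_X_add_C β).natDegree_pow, natDegree_X_add_C, mul_one]

theorem coeffPairing_X_pow_mul_eq_zero (m : ℕ) (s : PowerSeries R) (p : R[X])
    (h : p.natDegree < m) : coeffPairing (PowerSeries.X ^ m * s) p = 0 := by
  rw [coeffPairing_eq_sum]
  refine Finset.sum_eq_zero fun i hi => ?_
  rw [PowerSeries.coeff_X_pow_mul', if_neg, mul_zero]
  exact not_le.2 ((le_natDegree_of_mem_supp i hi).trans_lt h)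

theorem coeffPairing_directFamily_of_lt [Nontrivial R] (β : R) {l m : Fin N → ℕ} {k j : Fin N}
    (h : m j + (k : ℕ) < l k + (j : ℕ)) :
    coeffPairing (directFamily β l k) (dualFamily β m j) = 0 := by
  apply coeffPairing_X_pow_mul_eq_zero
  rw [natDegree_dualFamily]
  omega

/-- For `j ≤ k` the polynomial contains enough factors `X + β` to cancel the whole denominator. The
pairing then reads the coefficient of index `l k` in a multiple of `X ^ m j`. -/
theorem coeffPairing_directFamily_of_le (β : R) {l m : Fin N → ℕ} {k j : Fin N}
    (hjk : j ≤ k) (h : l k < m j) :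
    coeffPairing (directFamily β l k) (dualFamily β m j) = 0 := by
  have h1 : dualFamily β m j = (X + C β) ^ (N - 1 - (k : ℕ)) *
      (X ^ m j * (X + C β) ^ ((k : ℕ) - (j : ℕ))) := by
    rw [dualFamily, mul_left_comm, ← pow_add]
    congr 2
    have := Fin.le_def.1 hjk
    omega
  rw [directFamily, h1, coeffPairing_geomSeries, coeff_X_pow_mul', if_neg (not_le.2 h)]

theorem coeffPairing_directFamily_self (β : R) (l : Fin N → ℕ) (k : Fin N) :
    coeffPairing (directFamily β l k) (dualFamily β l k) = 1 := by
  rw [directFamily, dualFamily, mul_comm (X ^ _), coeffPairing_geomSeries]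
  simp

/-- Pigeonhole: a permutation avoiding the block would send the `a + 1` indices up to `a` into the
`a` indices below it. -/
theorem Matrix.det_eq_zero_of_block (A : Matrix (Fin N) (Fin N) R) (a : Fin N)
    (h : ∀ i j, a ≤ i → j ≤ a → A i j = 0) : A.det = 0 := by
  rw [Matrix.det_apply]
  refine Finset.sum_eq_zero fun σ _ => ?_
  suffices ∃ j, j ≤ a ∧ a ≤ σ j by
    obtain ⟨j, hj, hi⟩ := this
    have h0 : ∏ i, A (σ i) i = 0 := Finset.prod_eq_zero (Finset.mem_univ j) (h _ _ hi hj)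
    rw [h0, smul_zero]
  by_contra! hcon
  have h1 : (Finset.Iic a).map σ.toEmbedding ⊆ Finset.Iio a := by
    intro i hi
    obtain ⟨j, hj, rfl⟩ := Finset.mem_map.1 hi
    exact Finset.mem_Iio.2 (hcon j (Finset.mem_Iic.1 hj))
  have h2 := Finset.card_le_card h1
  rw [Finset.card_map, Fin.card_Iic, Fin.card_Iio] at h2
  omega

/-- For equal partitions the matrix is unitriangular. Otherwise, at an index `a` where they differ,
monotonicity spreads the inequality between `l a` and `m a` over a corner block through `(a, a)`,
whose entries vanish by cancellation of denominators or by degree, according to the sign. -/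
theorem det_coeffPairing_dualFamily [Nontrivial R] (β : R) {l m : Fin N → ℕ} (hl : Antitone l)
    (hm : Antitone m) :
    (Matrix.of fun j k => coeffPairing (directFamily β l k) (dualFamily β m j)).det =
      if l = m then 1 else 0 := by
  split_ifs with h
  · subst h
    rw [Matrix.det_of_isUpperTriangular]
    · simp [coeffPairing_directFamily_self]
    · intro j k hkj
      apply coeffPairing_directFamily_of_lt
      have h1 : k < j := hkj
      have h2 := hl h1.le
      have := Fin.lt_def.1 h1
      omega
  · obtain ⟨a, ha⟩ := Function.ne_iff.1 h
    rcases lt_or_gt_of_ne ha with ha | ha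
    · rw [← Matrix.det_transpose]
      apply Matrix.det_eq_zero_of_block _ a
      intro k j hk hj
      apply coeffPairing_directFamily_of_le β (hj.trans hk)
      exact (hl hk).trans_lt (ha.trans_le (hm hj))
    · apply Matrix.det_eq_zero_of_block _ a
      intro j k hj hk
      apply coeffPairing_directFamily_of_lt
      have h1 := hl hk
      have h2 := hm hj
      have := Fin.le_def.1 hj
      have := Fin.le_def.1 hk
      omega

end DualBases

/-! ### Expansion of alternating forms in the dual family -/

noncomputable section Expansion

open Polynomial

variable {R : Type*} [CommRing R] {N : ℕ}

theorem StrictAnti.add_val_antitone {f : Fin N → ℕ} (hf : StrictAnti f) :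
    Antitone fun k => f k + (k : ℕ) := by
  have key : ∀ d : ℕ, ∀ i j : Fin N, (j : ℕ) = i + d → f j + (j : ℕ) ≤ f i + i := by
    intro d
    induction d with
    | zero =>
      intro i j h
      rw [Fin.ext h]
    | succ d ih =>
      intro i j h
      have h1 := ih i ⟨i + d, by omega⟩ rfl
      have h2 : f j < f ⟨i + d, by omega⟩ := hf (Fin.lt_def.2 (by simp only []; omega))
      simp only [] at h1
      omega
  intro i j hij
  exact key (j - i) i j (by have := Fin.le_def.1 hij; omega)

/-- Induction on the sum of the exponents. Distinct exponents, sorted decreasingly, are a partition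
`l` plus the staircase; `dualFamily β l` has these monomials as leading terms, and all other terms
of its multilinear expansion have smaller exponent sum. -/
theorem AlternatingMap.map_X_pow_eq_zero [Nontrivial R] (β : R) (f : R[X] [⋀^Fin N]→ₗ[R] R)
    (B : ℕ)
    (hf : ∀ l : Fin N → ℕ, Antitone l → (∀ k, l k ≤ B) → f (dualFamily β l) = 0)
    (r : Fin N → ℕ) (hr : ∀ k, r k ≤ B) : f (fun k => X ^ r k) = 0 := by
  induction hs : ∑ k, r k using Nat.strong_induction_on generalizing r with
  | _ s ih =>
  by_cases hinj : Function.Injective r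
  swap
  · apply f.map_eq_zero_of_not_injective
    contrapose! hinj
    intro i j hij
    exact hinj (by simp only [hij])
  obtain ⟨σ, hσ⟩ : ∃ σ : Equiv.Perm (Fin N), StrictAnti (r ∘ σ) := by
    refine ⟨Fin.revPerm.trans (Tuple.sort r), ?_⟩
    have h1 : StrictMono (r ∘ Tuple.sort r) :=
      (Tuple.monotone_sort r).strictMono_of_injective (hinj.comp (Tuple.sort r).injective)
    intro i j hij
    exact h1 (Fin.rev_lt_rev.2 hij)
  set m := r ∘ σ with hm
  suffices f (fun k => X ^ m k) = 0 by
    have h1 := f.map_perm (fun k => (X : R[X]) ^ r k) σ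
    have h2 : ((fun k => (X : R[X]) ^ r k) ∘ σ) = fun k => X ^ m k := rfl
    rw [h2, this] at h1
    exact (smul_eq_zero_iff_eq _).1 h1.symm
  have hmB : ∀ k, m k ≤ B := fun k => hr _
  have hms : ∑ k, m k = s := by rw [← hs]; exact Equiv.sum_comp σ r
  have hanti := hσ.add_val_antitone
  have hge : ∀ k : Fin N, N - 1 - (k : ℕ) ≤ m k := by
    intro k
    -- Comparison with the last index, where the exponent is at least `0`.
    have h1 := hanti (show k ≤ ⟨N - 1, by have := k.2; omega⟩ from Fin.le_def.2 (by simp only []; omega))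
    simp only [] at h1
    omega
  set l : Fin N → ℕ := fun k => m k - (N - 1 - (k : ℕ)) with hl
  have hlm : ∀ k, l k + (N - 1 - (k : ℕ)) = m k := fun k => by
    have := hge k
    simp only [hl]
    omega
  have hla : Antitone l := by
    intro i j hij
    have h1 := hanti hij
    have h2 := hlm i
    have h3 := hlm j
    simp only [] at h1
    omega
  have h0 := hf l hla fun k => (Nat.sub_le _ _).trans (hmB k)
  have hexp : dualFamily β l = fun k => ∑ i ∈ Finset.range (m k + 1),
      (dualFamily β l k).coeff i • (X : R[X]) ^ i := by
    funext k
    conv_lhs => rw [(dualFamily β l k).as_sum_range' (m k + 1)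
      (by rw [natDegree_dualFamily, hlm]; exact Nat.lt_succ_self _)]
    exact Finset.sum_congr rfl fun i _ => by rw [smul_X_eq_monomial]
  have hsum := f.toMultilinearMap.map_sum_finset
    (fun k i => (dualFamily β l k).coeff i • (X : R[X]) ^ i)
    (fun k => Finset.range (m k + 1))
  rw [← hexp] at hsum
  have hval : f (dualFamily β l) = f (fun k => X ^ m k) := by
    refine hsum.trans ?_
    rw [Finset.sum_eq_single m]
    · rw [f.toMultilinearMap.map_smul_univ (fun k => (dualFamily β l k).coeff (m k))
        (fun k => (X : R[X]) ^ m k)]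
      have h1 : ∀ k, (dualFamily β l k).coeff (m k) = 1 := fun k => by
        have := monic_dualFamily β l k
        rw [Monic, leadingCoeff, natDegree_dualFamily, hlm] at this
        exact this
      simp [h1]
    · intro q hq hqm
      rw [f.toMultilinearMap.map_smul_univ (fun k => (dualFamily β l k).coeff (q k))
        (fun k => (X : R[X]) ^ q k)]
      have hle : ∀ k, q k ≤ m k := fun k => by
        have := Fintype.mem_piFinset.1 hq k
        exact Nat.lt_succ_iff.1 (Finset.mem_range.1 this)
      have hlt : ∑ k, q k < s := by
        rw [← hms]
        obtain ⟨a, ha⟩ := Function.ne_iff.1 hqm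
        exact Finset.sum_lt_sum (fun k _ => hle k)
          ⟨a, Finset.mem_univ _, lt_of_le_of_ne (hle a) ha⟩
      have := ih _ hlt q (fun k => (hle k).trans (hmB k)) rfl
      rw [AlternatingMap.coe_multilinearMap, this, smul_zero]
    · intro hnot
      exact absurd (Fintype.mem_piFinset.2 fun k => Finset.self_mem_range_succ _) hnot
  rw [← hval, h0]

theorem AlternatingMap.eq_zero_of_dualFamily [Nontrivial R] (β : R)
    (f : R[X] [⋀^Fin N]→ₗ[R] R) (B : ℕ)
    (hf : ∀ l : Fin N → ℕ, Antitone l → (∀ k, l k ≤ B) → f (dualFamily β l) = 0)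
    (p : Fin N → R[X]) (hp : ∀ k, (p k).natDegree ≤ B) : f p = 0 := by
  have hexp : p = fun k => ∑ i ∈ Finset.range (B + 1), (p k).coeff i • (X : R[X]) ^ i := by
    funext k
    conv_lhs => rw [(p k).as_sum_range' (B + 1) (Nat.lt_succ_of_le (hp k))]
    exact Finset.sum_congr rfl fun i _ => by rw [smul_X_eq_monomial]
  have hsum := f.toMultilinearMap.map_sum_finset
    (fun k i => (p k).coeff i • (X : R[X]) ^ i) (fun _ => Finset.range (B + 1))
  rw [← hexp] at hsum
  refine hsum.trans (Finset.sum_eq_zero fun q hq => ?_)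
  rw [f.toMultilinearMap.map_smul_univ (fun k => (p k).coeff (q k))
    (fun k => (X : R[X]) ^ q k), AlternatingMap.coe_multilinearMap,
    f.map_X_pow_eq_zero β B hf q, smul_zero]
  intro k
  have := Fintype.mem_piFinset.1 hq k
  exact Nat.lt_succ_iff.1 (Finset.mem_range.1 this)

theorem finite_partitions_le (N B : ℕ) : {l : Partitions N | ∀ k, l.1 k ≤ B}.Finite :=
  (Set.finite_Iic (fun _ : Fin N => B)).preimage Subtype.val_injective.injOn

/-- Expansion of an antisymmetrized product of polynomials in the dual Grothendieck basis. -/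
theorem det_eval_eq_sum [Nontrivial R] (β : R) (B : ℕ) (p : Fin N → R[X])
    (hp : ∀ k, (p k).natDegree ≤ B) (y : Fin N → R) :
    (Matrix.of fun j k => (p j).eval (y k)).det =
      ∑ l ∈ (finite_partitions_le N B).toFinset,
        (Matrix.of fun j k => coeffPairing (directFamily β l.1 k) (p j)).det *
        (Matrix.of fun j k => (dualFamily β l.1 j).eval (y k)).det := by
  set g : (Fin N → R[X] →ₗ[R] R) → R[X] [⋀^Fin N]→ₗ[R] R := fun φ =>
    (Matrix.detRowAlternating (R := R) (n := Fin N)).compLinearMap (LinearMap.pi φ) with hg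
  set w : Partitions N → R := fun l => (Matrix.of fun j k => (dualFamily β l.1 j).eval (y k)).det
    with hw
  -- Both sides are alternating in the polynomials, so it suffices that their difference vanishes on
  -- dual families, which is biorthogonality.
  set f : R[X] [⋀^Fin N]→ₗ[R] R := g (fun k => Polynomial.leval (y k)) -
    ∑ l ∈ (finite_partitions_le N B).toFinset, w l • g (fun k => coeffPairing (directFamily β l.1 k))
    with hf
  have map_sum_apply : ∀ (F : Partitions N → R[X] [⋀^Fin N]→ₗ[R] R) (S : Finset (Partitions N))
      (q : Fin N → R[X]), (∑ l ∈ S, F l) q = ∑ l ∈ S, F l q := fun F S q =>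
    map_sum (⟨⟨fun f => f q, rfl⟩, fun _ _ => rfl⟩ : (R[X] [⋀^Fin N]→ₗ[R] R) →+ R) F S
  have hfp : ∀ q : Fin N → R[X], f q = (Matrix.of fun j k => (q j).eval (y k)).det -
      ∑ l ∈ (finite_partitions_le N B).toFinset,
        (Matrix.of fun j k => coeffPairing (directFamily β l.1 k) (q j)).det * w l := by
    intro q
    rw [hf, AlternatingMap.sub_apply, map_sum_apply]
    congr 1
    refine Finset.sum_congr rfl fun l _ => ?_
    rw [AlternatingMap.smul_apply, smul_eq_mul, mul_comm]
    rfl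
  refine sub_eq_zero.1 ((hfp p).symm.trans (f.eq_zero_of_dualFamily β B ?_ p hp))
  intro l hl hlB
  rw [hfp, Finset.sum_eq_single (⟨l, hl⟩ : Partitions N)]
  · rw [det_coeffPairing_dualFamily β hl hl, if_pos rfl, one_mul, hw, sub_self]
  · intro m _ hne
    rw [det_coeffPairing_dualFamily β m.2 hl, if_neg, zero_mul]
    rintro rfl
    exact hne rfl
  · intro hnot
    exact (hnot ((Set.Finite.mem_toFinset _).2 hlB)).elim

theorem hasSum_det_eval [Nontrivial R] [TopologicalSpace R] (β : R) (p : Fin N → R[X])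
    (y : Fin N → R) :
    HasSum (fun l : Partitions N =>
        (Matrix.of fun j k => coeffPairing (directFamily β l.1 k) (p j)).det *
        (Matrix.of fun j k => (dualFamily β l.1 j).eval (y k)).det)
      (Matrix.of fun j k => (p j).eval (y k)).det := by
  set B := ∑ k, (p k).natDegree with hB
  have hp : ∀ k, (p k).natDegree ≤ B := fun k =>
    Finset.single_le_sum (f := fun k => (p k).natDegree) (fun _ _ => Nat.zero_le _)
      (Finset.mem_univ k)
  rw [det_eval_eq_sum β B p hp y]
  apply hasSum_sum_of_ne_finset_zero
  intro l hl
  -- Outside the finite set some series has order above every degree of `p`, which gives a zero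
  -- column.
  obtain ⟨k, hk⟩ : ∃ k, B < l.1 k := by
    simpa [Set.Finite.mem_toFinset] using hl
  rw [Matrix.det_eq_zero_of_column_eq_zero k, zero_mul]
  intro j
  apply coeffPairing_X_pow_mul_eq_zero
  have := hp j
  omega

end Expansion

/-! ### Passage from truncated kernels to the Cauchy kernel -/

noncomputable section Limit

open Polynomial Filter Topology

variable {N : ℕ}

theorem Matrix.norm_det_le_of_columns (A : Matrix (Fin N) (Fin N) ℂ) (b : Fin N → ℝ)
    (h : ∀ j k, ‖A j k‖ ≤ b k) : ‖A.det‖ ≤ (N.factorial : ℝ) * ∏ k, b k := by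
  rw [Matrix.det_apply]
  refine (norm_sum_le _ _).trans ?_
  have h1 : ∀ σ ∈ (Finset.univ : Finset (Equiv.Perm (Fin N))),
      ‖Equiv.Perm.sign σ • ∏ k, A (σ k) k‖ ≤ ∏ k, b k := by
    intro σ _
    have h2 : ‖Equiv.Perm.sign σ • ∏ k, A (σ k) k‖ = ∏ k, ‖A (σ k) k‖ := by
      rcases Int.units_eq_one_or (Equiv.Perm.sign σ) with h | h <;> simp [h, norm_prod]
    rw [h2]
    exact Finset.prod_le_prod (fun _ _ => norm_nonneg _) fun k _ => h _ _
  refine (Finset.sum_le_card_nsmul _ _ _ h1).trans_eq ?_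
  rw [Finset.card_univ, Fintype.card_perm, Fintype.card_fin, nsmul_eq_mul]

theorem summable_prod_pow {r : ℝ} (h0 : 0 ≤ r) (h1 : r < 1) :
    Summable fun l : Partitions N => ∏ k, r ^ l.1 k := by
  suffices Summable fun l : Fin N → ℕ => ∏ k, r ^ l k from
    this.comp_injective Subtype.val_injective
  refine summable_of_sum_le (c := ∏ _k : Fin N, (1 - r)⁻¹)
    (fun l => Finset.prod_nonneg fun k _ => pow_nonneg h0 _) fun u => ?_
  set B := ∑ l ∈ u, ∑ k, l k with hB
  have hu : u ⊆ Fintype.piFinset fun _ : Fin N => Finset.range (B + 1) := by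
    intro l hl
    refine Fintype.mem_piFinset.2 fun k => Finset.mem_range.2 (Nat.lt_succ_of_le ?_)
    exact (Finset.single_le_sum (f := fun k => l k) (fun _ _ => Nat.zero_le _)
      (Finset.mem_univ k)).trans
      (Finset.single_le_sum (f := fun l : Fin N → ℕ => ∑ k, l k) (fun _ _ => Nat.zero_le _) hl)
  refine (Finset.sum_le_sum_of_subset_of_nonneg hu
    fun l _ _ => Finset.prod_nonneg fun k _ => pow_nonneg h0 _).trans ?_
  rw [Finset.sum_prod_piFinset (Finset.range (B + 1)) fun (_ : Fin N) i => r ^ i]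
  refine Finset.prod_le_prod (fun k _ => Finset.sum_nonneg fun i _ => pow_nonneg h0 _)
    fun k _ => ?_
  rw [← tsum_geometric_of_lt_one h0 h1]
  exact (summable_geometric_of_lt_one h0 h1).sum_le_tsum _ fun i _ => pow_nonneg h0 _

/-- The polynomials `X ^ (l_k + N - 1 - k) (1 + β X) ^ k`, for `k < N`. -/
def directPoly {R : Type*} [CommRing R] (β : R) (l : Fin N → ℕ) (k : Fin N) : R[X] :=
  X ^ (l k + (N - 1 - (k : ℕ))) * (1 + C β * X) ^ (k : ℕ)

/-- Clearing denominators leaves a polynomial, so the radius of convergence of `geomSeries β`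
imposes no condition on `z`. -/
theorem mul_directFamily {R : Type*} [CommRing R] (β : R) (l : Fin N → ℕ) (k : Fin N) :
    (((1 + C β * X) ^ (N - 1) : R[X]) : PowerSeries R) * directFamily β l k =
      (directPoly β l k : PowerSeries R) := by
  have h1 : N - 1 = k + (N - 1 - (k : ℕ)) := by omega
  have h2 := geomSeries_mul β
  simp only [directFamily, directPoly]
  push_cast
  nth_rw 1 [h1]
  set u : PowerSeries R := 1 + PowerSeries.C β * PowerSeries.X with hu
  calc u ^ ((k : ℕ) + (N - 1 - (k : ℕ))) * (PowerSeries.X ^ (l k + (N - 1 - (k : ℕ))) *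
        geomSeries β ^ (N - 1 - (k : ℕ)))
      = PowerSeries.X ^ (l k + (N - 1 - (k : ℕ))) * u ^ (k : ℕ) *
        (u * geomSeries β) ^ (N - 1 - (k : ℕ)) := by rw [pow_add, mul_pow]; ring
    _ = _ := by rw [h2, one_pow, mul_one]

/-- The truncation, to terms of degree less than `M` in `z`, of `a(z) / (1 - z X)`. -/
def kernelPoly (a : ℂ[X]) (z : ℂ) (M : ℕ) : ℂ[X] :=
  ∑ i ∈ Finset.range M, ∑ q ∈ Finset.HasAntidiagonal.antidiagonal i, monomial q.2 (z ^ i * a.coeff q.1)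

theorem coeffPairing_kernelPoly (s : PowerSeries ℂ) (a : ℂ[X]) (z : ℂ) (M : ℕ) :
    coeffPairing s (kernelPoly a z M) =
      ∑ i ∈ Finset.range M, z ^ i * PowerSeries.coeff i ((a : PowerSeries ℂ) * s) := by
  rw [kernelPoly, map_sum]
  refine Finset.sum_congr rfl fun i _ => ?_
  rw [map_sum, PowerSeries.coeff_mul, Finset.mul_sum]
  refine Finset.sum_congr rfl fun q _ => ?_
  rw [coeffPairing_monomial, Polynomial.coeff_coe, mul_assoc]

/-- Cauchy product of the finite expansion of `a` at `z` with the geometric series in `z * y`. -/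
theorem tendsto_eval_kernelPoly (a : ℂ[X]) {z y : ℂ} (h : ‖z * y‖ < 1) :
    Tendsto (fun M => (kernelPoly a z M).eval y) atTop (𝓝 (a.eval z / (1 - z * y))) := by
  have hz : ∀ i ∉ Finset.range (a.natDegree + 1), a.coeff i * z ^ i = 0 := fun i hi => by
    rw [coeff_eq_zero_of_natDegree_lt (by simpa using hi), zero_mul]
  have hf : HasSum (fun i => a.coeff i * z ^ i) (a.eval z) := by
    rw [eval_eq_sum_range]
    exact hasSum_sum_of_ne_finset_zero hz
  have hf' : Summable fun i => ‖a.coeff i * z ^ i‖ :=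
    summable_of_ne_finset_zero (s := Finset.range (a.natDegree + 1)) fun i hi => by
      rw [hz i hi, norm_zero]
  have hg' : Summable fun i => ‖(z * y) ^ i‖ := by
    simpa only [norm_pow] using summable_geometric_of_lt_one (norm_nonneg _) h
  have hs := (summable_norm_sum_mul_antidiagonal_of_summable_norm hf' hg').of_norm.hasSum
  rw [← tsum_mul_tsum_eq_tsum_sum_antidiagonal_of_summable_norm hf' hg', hf.tsum_eq,
    tsum_geometric_of_norm_lt_one h, ← div_eq_mul_inv] at hs
  convert hs.tendsto_sum_nat using 2 with M
  simp only [kernelPoly, eval_finsetSum, eval_monomial]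
  refine Finset.sum_congr rfl fun i _ => Finset.sum_congr rfl fun q hq => ?_
  rw [← Finset.HasAntidiagonal.mem_antidiagonal.1 hq]
  ring

theorem tendsto_sum_coeff (p : ℂ[X]) (z : ℂ) :
    Tendsto (fun M => ∑ i ∈ Finset.range M, z ^ i * p.coeff i) atTop (𝓝 (p.eval z)) := by
  apply tendsto_const_nhds.congr'
  filter_upwards [eventually_gt_atTop p.natDegree] with M hM
  rw [eval_eq_sum_range' hM]
  exact Finset.sum_congr rfl fun i _ => mul_comm _ _

/-- The sum of the absolute values of the terms of `q(z)`. -/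
def absEval (q : ℂ[X]) (r : ℝ) : ℝ := ∑ i ∈ Finset.range (q.natDegree + 1), r ^ i * ‖q.coeff i‖

/-- The bound is uniform in the truncation `M`; the factor `r ^ m` provides the decay in the
partition needed for domination. -/
theorem norm_sum_coeff_X_pow_mul_le (q : ℂ[X]) {z : ℂ} {r : ℝ} (hz : ‖z‖ ≤ r) (m M : ℕ) :
    ‖∑ i ∈ Finset.range M, z ^ i * (X ^ m * q).coeff i‖ ≤ absEval q r * r ^ m := by
  have hr : 0 ≤ r := (norm_nonneg z).trans hz
  have hnn : ∀ i, 0 ≤ r ^ i * ‖(X ^ m * q).coeff i‖ := fun i =>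
    mul_nonneg (pow_nonneg hr _) (norm_nonneg _)
  have h1 : ‖∑ i ∈ Finset.range M, z ^ i * (X ^ m * q).coeff i‖ ≤
      ∑ i ∈ Finset.range M, r ^ i * ‖(X ^ m * q).coeff i‖ := by
    refine (norm_sum_le _ _).trans (Finset.sum_le_sum fun i _ => ?_)
    rw [norm_mul, norm_pow]
    exact mul_le_mul_of_nonneg_right (pow_le_pow_left₀ (norm_nonneg _) hz i) (norm_nonneg _)
  have h2 : ∑ i ∈ Finset.range M, r ^ i * ‖(X ^ m * q).coeff i‖ ≤
      ∑ i ∈ Finset.range (m + M), r ^ i * ‖(X ^ m * q).coeff i‖ :=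
    Finset.sum_le_sum_of_subset_of_nonneg (Finset.range_mono (Nat.le_add_left _ _))
      fun i _ _ => hnn i
  have h3 : ∑ i ∈ Finset.range (m + M), r ^ i * ‖(X ^ m * q).coeff i‖ =
      (∑ i ∈ Finset.range M, r ^ i * ‖q.coeff i‖) * r ^ m := by
    rw [Finset.sum_range_add, Finset.sum_eq_zero, zero_add, Finset.sum_mul]
    · refine Finset.sum_congr rfl fun i _ => ?_
      rw [add_comm m i, coeff_X_pow_mul, pow_add]
      ring
    · intro i hi
      rw [coeff_X_pow_mul', if_neg (not_le.2 (Finset.mem_range.1 hi)), norm_zero, mul_zero]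
  have h4 : ∑ i ∈ Finset.range M, r ^ i * ‖q.coeff i‖ ≤ absEval q r := by
    have h5 : HasSum (fun i => r ^ i * ‖q.coeff i‖) (absEval q r) :=
      hasSum_sum_of_ne_finset_zero fun i hi => by
        rw [coeff_eq_zero_of_natDegree_lt (by simpa using hi), norm_zero, mul_zero]
    exact sum_le_hasSum _ (fun i _ => mul_nonneg (pow_nonneg hr _) (norm_nonneg _)) h5
  exact (h1.trans (h2.trans_eq h3)).trans (mul_le_mul_of_nonneg_right h4 (pow_nonneg hr _))

theorem norm_eval_X_pow_mul_le (q : ℂ[X]) {z : ℂ} {r : ℝ} (hz : ‖z‖ ≤ r) (m : ℕ) :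
    ‖(X ^ m * q).eval z‖ ≤ absEval q r * r ^ m :=
  le_of_tendsto (tendsto_sum_coeff _ z).norm
    (Eventually.of_forall fun M => norm_sum_coeff_X_pow_mul_le q hz m M)

theorem hasSum_det_directPoly_mul_det_dualFamily (β : ℂ) (z y : Fin N → ℂ)
    (h : ‖z‖ * ‖y‖ < 1) :
    HasSum (fun l : Partitions N =>
        (Matrix.of fun j k => (directPoly β l.1 k).eval (z j)).det *
        (Matrix.of fun j k => (dualFamily β l.1 j).eval (y k)).det)
      (Matrix.of fun j k => (1 + β * z j) ^ (N - 1) / (1 - z j * y k)).det := by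
  set F : ℕ → Partitions N → ℂ := fun M l =>
    (Matrix.of fun j k =>
      coeffPairing (directFamily β l.1 k) (kernelPoly ((1 + C β * X) ^ (N - 1)) (z j) M)).det *
    (Matrix.of fun j k => (dualFamily β l.1 j).eval (y k)).det with hF
  set G : Partitions N → ℂ := fun l =>
    (Matrix.of fun j k => (directPoly β l.1 k).eval (z j)).det *
    (Matrix.of fun j k => (dualFamily β l.1 j).eval (y k)).det with hG
  set c : Fin N → ℝ := fun k => absEval ((1 + C β * X) ^ (k : ℕ)) ‖z‖ with hc
  set d : Fin N → ℝ := fun k => absEval ((X + C β) ^ (N - 1 - (k : ℕ))) ‖y‖ with hd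
  set K : ℝ := (N.factorial : ℝ) * (∏ k, c k * ‖z‖ ^ (N - 1 - (k : ℕ))) *
    ((N.factorial : ℝ) * ∏ k, d k) with hK
  have hentry : ∀ (l : Partitions N) (j k : Fin N) (M : ℕ),
      coeffPairing (directFamily β l.1 k) (kernelPoly ((1 + C β * X) ^ (N - 1)) (z j) M) =
        ∑ i ∈ Finset.range M, z j ^ i * (directPoly β l.1 k).coeff i := fun l j k M => by
    rw [coeffPairing_kernelPoly, mul_directFamily]
    simp only [Polynomial.coeff_coe]
  have hlim : ∀ l, Tendsto (fun M => F M l) atTop (𝓝 (G l)) := by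
    intro l
    refine Tendsto.mul_const _ ?_
    simp only [Matrix.det_apply, Matrix.of_apply, hentry]
    refine tendsto_finsetSum _ fun σ _ => Tendsto.const_smul ?_ _
    exact tendsto_finsetProd _ fun k _ => tendsto_sum_coeff _ _
  have hbound : ∀ M l, ‖F M l‖ ≤ K * ∏ k, (‖z‖ * ‖y‖) ^ l.1 k := by
    intro M l
    have h1 : ‖(Matrix.of fun j k => coeffPairing (directFamily β l.1 k)
        (kernelPoly ((1 + C β * X) ^ (N - 1)) (z j) M)).det‖ ≤
        (N.factorial : ℝ) * ∏ k, c k * ‖z‖ ^ (l.1 k + (N - 1 - (k : ℕ))) := by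
      apply Matrix.norm_det_le_of_columns
      intro j k
      rw [Matrix.of_apply, hentry]
      exact norm_sum_coeff_X_pow_mul_le _ (norm_le_pi_norm z j) _ _
    have h2 : ‖(Matrix.of fun j k => (dualFamily β l.1 j).eval (y k)).det‖ ≤
        (N.factorial : ℝ) * ∏ k, d k * ‖y‖ ^ l.1 k := by
      rw [← Matrix.det_transpose]
      apply Matrix.norm_det_le_of_columns
      intro j k
      exact norm_eval_X_pow_mul_le _ (norm_le_pi_norm y j) _
    rw [hF, norm_mul]
    refine (mul_le_mul h1 h2 (norm_nonneg _) ((norm_nonneg _).trans h1)).trans_eq ?_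
    simp only [hK, pow_add, mul_pow, Finset.prod_mul_distrib]
    ring
  have hsum : Summable fun l : Partitions N => K * ∏ k, (‖z‖ * ‖y‖) ^ l.1 k :=
    (summable_prod_pow (mul_nonneg (norm_nonneg _) (norm_nonneg _)) h).mul_left K
  have hGs : Summable G := hsum.of_norm_bounded fun l =>
    le_of_tendsto (hlim l).norm (Eventually.of_forall fun M => hbound M l)
  -- For each fixed `M` the sum is the polynomial expansion; only the limit in `M` needs analysis.
  have ht := tendsto_tsum_of_dominated_convergence hsum hlim
    (Eventually.of_forall fun M l => hbound M l)
  have hFM : ∀ M, ∑' l, F M l = (Matrix.of fun j k =>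
      (kernelPoly ((1 + C β * X) ^ (N - 1)) (z j) M).eval (y k)).det := fun M =>
    (hasSum_det_eval β _ y).tsum_eq
  have hR : Tendsto (fun M => (Matrix.of fun j k =>
      (kernelPoly ((1 + C β * X) ^ (N - 1)) (z j) M).eval (y k)).det) atTop
      (𝓝 (Matrix.of fun j k => (1 + β * z j) ^ (N - 1) / (1 - z j * y k)).det) := by
    simp only [Matrix.det_apply, Matrix.of_apply]
    refine tendsto_finsetSum _ fun σ _ => Tendsto.const_smul ?_ _
    refine tendsto_finsetProd _ fun k _ => ?_
    have h1 : ‖z (σ k) * y k‖ < 1 := by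
      rw [norm_mul]
      exact (mul_le_mul (norm_le_pi_norm z _) (norm_le_pi_norm y _) (norm_nonneg _)
        (norm_nonneg _)).trans_lt h
    have h2 := tendsto_eval_kernelPoly ((1 + C β * X) ^ (N - 1)) h1
    simpa using h2
  rw [← tendsto_nhds_unique (ht.congr hFM) hR]
  exact hGs.hasSum

end Limit

/-! ### Divided differences and determinants -/

noncomputable section DividedDifferences

open Polynomial

variable {R : Type*} [CommRing R] {N : ℕ}

/-- The polynomial in `w` of the divided differences `p[x_0, …, x_{n-1}, w]`. -/
def dividedDifference (x : ℕ → R) : ℕ → R[X] → R[X]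
  | 0, p => p
  | n + 1, p => dividedDifference x n p /ₘ (X - C (x n))

theorem dividedDifference_succ_spec (x : ℕ → R) (n : ℕ) (p : R[X]) :
    C ((dividedDifference x n p).eval (x n)) +
      (X - C (x n)) * dividedDifference x (n + 1) p = dividedDifference x n p := by
  rw [← modByMonic_X_sub_C_eq_C_eval]
  exact modByMonic_add_div _ _

theorem newton_expansion (x : ℕ → R) (p : R[X]) (n : ℕ) :
    p = ∑ i ∈ Finset.range n, (∏ m ∈ Finset.range i, (X - C (x m))) *
        C ((dividedDifference x i p).eval (x i)) +
      (∏ m ∈ Finset.range n, (X - C (x m))) * dividedDifference x n p := by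
  induction n with
  | zero => simp [dividedDifference]
  | succ n ih =>
    conv_lhs => rw [ih, ← dividedDifference_succ_spec x n p]
    rw [Finset.sum_range_succ, Finset.prod_range_succ]
    ring

theorem map_dividedDifference {S : Type*} [CommRing S] (φ : R →+* S) (x : ℕ → R) (n : ℕ)
    (p : R[X]) :
    (dividedDifference x n p).map φ = dividedDifference (fun i => φ (x i)) n (p.map φ) := by
  induction n with
  | zero => rfl
  | succ n ih =>
    rw [dividedDifference, dividedDifference, map_divByMonic _ (monic_X_sub_C _), ih]
    simp

/-- The extension by zero of an `N`-tuple to a sequence. -/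
def extendZero (v : Fin N → R) : ℕ → R := Function.extend Fin.val v 0

@[simp]
theorem extendZero_val (v : Fin N → R) (j : Fin N) : extendZero v j = v j :=
  Fin.val_injective.extend_apply v 0 j

theorem map_extendZero {S : Type*} [CommRing S] (φ : R →+* S) (v : Fin N → R) :
    (fun i => φ (extendZero v i)) = extendZero fun j => φ (v j) := by
  funext i
  by_cases h : i < N
  · exact (congrArg φ (extendZero_val v ⟨i, h⟩)).trans
      (extendZero_val (fun j => φ (v j)) ⟨i, h⟩).symm
  · have h' : ¬∃ j : Fin N, (j : ℕ) = i := fun ⟨j, hj⟩ => h (hj ▸ j.2)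
    simp [extendZero, Function.extend_apply' _ _ _ h']

/-- The determinant of the divided differences of the polynomials `p_k` at the points `v_j`: it is
the quotient of `det (p_k (v_j))` by the Vandermonde determinant. -/
def newtonDet (v : Fin N → R) (p : Fin N → R[X]) : R :=
  (Matrix.of fun j k : Fin N => (dividedDifference (extendZero v) j (p k)).eval (v j)).det

/-- Newton interpolation factors the matrix of values: the Newton polynomials are monic of degree
`i`, so their values have the Vandermonde determinant. -/
theorem det_eval_eq_det_vandermonde_mul [Nontrivial R] (v : Fin N → R) (p : Fin N → R[X]) :
    (Matrix.of fun j k => (p k).eval (v j)).det =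
      (Matrix.vandermonde v).det * newtonDet v p := by
  set q : Fin N → R[X] := fun i => ∏ m ∈ Finset.range i, (X - C (extendZero v m)) with hq
  rw [Matrix.det_eval_matrixOfPolynomials_eq_det_vandermonde v q
    (fun i => by rw [hq, natDegree_prod_of_monic _ _ fun m _ => monic_X_sub_C _]; simp)
    (fun i => monic_prod_of_monic _ _ fun m _ => monic_X_sub_C _), newtonDet, ← Matrix.det_mul]
  congr 1
  ext j k
  have h := congrArg (eval (v j)) (newton_expansion (extendZero v) (p k) N)
  -- The Newton remainder vanishes at every node.
  have h0 : ∏ m ∈ Finset.range N, (v j - extendZero v m) = 0 :=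
    Finset.prod_eq_zero (Finset.mem_range.2 j.2) (by rw [extendZero_val, sub_self])
  simp only [eval_add, eval_finsetSum, eval_mul, eval_C, eval_prod, eval_sub, eval_X, h0,
    zero_mul, add_zero] at h
  rw [Matrix.of_apply, h, ← Fin.sum_univ_eq_sum_range (fun i =>
    (∏ m ∈ Finset.range i, (v j - extendZero v m)) *
      (dividedDifference (extendZero v) i (p k)).eval (extendZero v i)), Matrix.mul_apply]
  simp [hq, eval_prod]

theorem map_newtonDet {S : Type*} [CommRing S] (φ : R →+* S) (v : Fin N → R)
    (p : Fin N → R[X]) :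
    φ (newtonDet v p) = newtonDet (fun j => φ (v j)) fun k => (p k).map φ := by
  rw [newtonDet, newtonDet, RingHom.map_det]
  congr 1
  ext j k
  simp only [RingHom.mapMatrix_apply, Matrix.map_apply, Matrix.of_apply]
  rw [← map_extendZero, ← map_dividedDifference, eval_map_apply]

/-- By the maximum principle it suffices to bound on the circle of radius `r`, where `w - x n` has
norm at least `r - s`. Hence the bound does not see how close the nodes are to each other. -/
theorem norm_eval_dividedDifference_le (x : ℕ → ℂ) (p : ℂ[X]) {r s B : ℝ} (hs : 0 ≤ s)
    (hrs : s < r) (hx : ∀ i, ‖x i‖ ≤ s) (hp : ∀ w, ‖w‖ ≤ r → ‖p.eval w‖ ≤ B) (n : ℕ) :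
    ∀ w, ‖w‖ ≤ r → ‖(dividedDifference x n p).eval w‖ ≤ B * (2 / (r - s)) ^ n := by
  induction n with
  | zero => simpa [dividedDifference] using hp
  | succ n ih =>
    intro w hw
    have hr : r ≠ 0 := (hs.trans_lt hrs).ne'
    refine Complex.norm_le_of_forall_mem_frontier_norm_le (U := Metric.ball (0 : ℂ) r)
      (f := fun w => (dividedDifference x (n + 1) p).eval w) Metric.isBounded_ball
      (Polynomial.differentiable _).diffContOnCl (fun u hu => ?_)
      (by rw [closure_ball _ hr]; simpa using hw)
    rw [frontier_ball _ hr, mem_sphere_zero_iff_norm] at hu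
    have h1 := congrArg (eval u) (dividedDifference_succ_spec x n p)
    simp only [eval_add, eval_C, eval_mul, eval_sub, eval_X] at h1
    have h2 : r - s ≤ ‖u - x n‖ := by
      have := norm_sub_norm_le u (x n)
      have := hx n
      linarith
    have h3 : ‖(u - x n) * (dividedDifference x (n + 1) p).eval u‖ ≤
        2 * (B * (2 / (r - s)) ^ n) := by
      rw [eq_sub_of_add_eq' h1]
      refine (norm_sub_le _ _).trans ?_
      have := ih u hu.le
      have := ih (x n) ((hx n).trans hrs.le)
      linarith
    rw [norm_mul] at h3
    have h4 : 0 < r - s := sub_pos.2 hrs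
    have h5 := (mul_le_mul_of_nonneg_right h2 (norm_nonneg _)).trans h3
    rw [pow_succ]
    calc ‖(dividedDifference x (n + 1) p).eval u‖ ≤ 2 * (B * (2 / (r - s)) ^ n) / (r - s) := by
          rw [le_div_iff₀ h4, mul_comm]
          exact h5
      _ = _ := by ring

theorem norm_newtonDet_le (v : Fin N → ℂ) (p : Fin N → ℂ[X]) {r s : ℝ} (B : Fin N → ℝ)
    (hs : 0 ≤ s) (hrs : s < r) (hv : ‖v‖ ≤ s)
    (hp : ∀ k, ∀ w, ‖w‖ ≤ r → ‖(p k).eval w‖ ≤ B k) :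
    ‖newtonDet v p‖ ≤ (N.factorial : ℝ) * ∏ k, B k * (1 + 2 / (r - s)) ^ N := by
  apply Matrix.norm_det_le_of_columns
  intro j k
  have hx : ∀ i, ‖extendZero v i‖ ≤ s := by
    intro i
    by_cases h : i < N
    · have h1 := extendZero_val v ⟨i, h⟩
      simp only [] at h1
      rw [h1]
      exact (norm_le_pi_norm v _).trans hv
    · have h' : ¬∃ j : Fin N, (j : ℕ) = i := fun ⟨j, hj⟩ => h (hj ▸ j.2)
      simpa [extendZero, Function.extend_apply' _ _ _ h'] using hs
  have hvj : ‖v j‖ ≤ r := ((norm_le_pi_norm v j).trans hv).trans hrs.le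
  have h0 : 0 ≤ 2 / (r - s) := div_nonneg zero_le_two (sub_pos.2 hrs).le
  refine (norm_eval_dividedDifference_le _ (p k) hs hrs hx (hp k) j _ hvj).trans ?_
  refine mul_le_mul_of_nonneg_left ?_ ((norm_nonneg _).trans (hp k _ hvj))
  -- Adding `1` makes the base at least `1`, so the row-dependent exponent `j` may be replaced by
  -- `N`.
  exact (pow_le_pow_left₀ h0 (le_add_of_nonneg_left zero_le_one) _).trans
    (pow_le_pow_right₀ (le_add_of_nonneg_right h0) j.2.le)

theorem det_eval_eq_of_natDegree_lt (v : Fin N → R) (p : Fin N → R[X])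
    (hp : ∀ k, (p k).natDegree < N) :
    (Matrix.of fun j k => (p k).eval (v j)).det =
      (Matrix.vandermonde v).det * (Matrix.of fun i k : Fin N => (p k).coeff i).det := by
  rw [← Matrix.det_mul]
  congr 1
  ext j k
  rw [Matrix.of_apply, eval_eq_sum_range' (hp k), Matrix.mul_apply,
    ← Fin.sum_univ_eq_sum_range fun i => (p k).coeff i * v j ^ i]
  exact Finset.sum_congr rfl fun i _ => mul_comm _ _

/-- Cauchy's determinant. -/
theorem det_one_div_one_sub_mul {F : Type*} [Field F] (z y : Fin N → F)
    (hy : Function.Injective y) (hy0 : ∀ k, y k ≠ 0) (hzy : ∀ j k, 1 - z j * y k ≠ 0) :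
    (Matrix.of fun j k => 1 / (1 - z j * y k)).det =
      (Matrix.vandermonde z).det * (Matrix.vandermonde y).det *
        ∏ j, ∏ k, 1 / (1 - z j * y k) := by
  -- Numerators of the entries over the common row denominator, with degree below `N`.
  set p : Fin N → F[X] := fun k => ∏ m ∈ {k}ᶜ, (1 - C (y m) * X) with hp
  have hev : ∀ k w, (p k).eval w = ∏ m ∈ {k}ᶜ, (1 - y m * w) := fun k w => by
    simp [hp, eval_prod]
  have hdeg : ∀ k, (p k).natDegree < N := by
    intro k
    have h1 : ∀ m, (1 - C (y m) * X : F[X]).natDegree ≤ 1 := fun m => by compute_degree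
    have h2 : (p k).natDegree ≤ N - 1 := by
      refine (natDegree_prod_le _ _).trans ((Finset.sum_le_card_nsmul _ _ 1 fun m _ => h1 m).trans ?_)
      simp [Finset.card_compl]
    have := k.2
    omega
  have hz := det_eval_eq_of_natDegree_lt z p hdeg
  -- At the points `(y j)⁻¹` the matrix of values is diagonal; this determines the coefficient
  -- determinant without expanding the polynomials.
  have hw := det_eval_eq_of_natDegree_lt (fun k => (y k)⁻¹) p hdeg
  have hdiag : (Matrix.of fun j k => (p k).eval ((y j)⁻¹)).det =
      ∏ k, ∏ m ∈ {k}ᶜ, (1 - y m * (y k)⁻¹) := by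
    rw [← Matrix.det_diagonal]
    congr 1
    ext j k
    rw [Matrix.of_apply, hev]
    by_cases hjk : j = k
    · rw [hjk, Matrix.diagonal_apply_eq]
    · rw [Matrix.diagonal_apply_ne _ hjk]
      exact Finset.prod_eq_zero (by simpa using hjk) (by rw [mul_inv_cancel₀ (hy0 j), sub_self])
  have hvand : (Matrix.vandermonde fun k => (y k)⁻¹).det * (Matrix.vandermonde y).det =
      ∏ k, ∏ m ∈ {k}ᶜ, (1 - y m * (y k)⁻¹) := by
    rw [← Finset.prod_prod_Ioi_mul_eq_prod_prod_off_diag (fun m k => 1 - y m * (y k)⁻¹),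
      Matrix.det_vandermonde, Matrix.det_vandermonde, ← Finset.prod_mul_distrib]
    refine Finset.prod_congr rfl fun k _ => ?_
    rw [← Finset.prod_mul_distrib]
    refine Finset.prod_congr rfl fun m _ => ?_
    have := hy0 k
    have := hy0 m
    field_simp
  have hcy : (Matrix.of fun i k : Fin N => (p k).coeff i).det = (Matrix.vandermonde y).det := by
    refine mul_left_cancel₀ (Matrix.det_vandermonde_ne_zero_iff.2 fun i j hij => hy ?_)
      (hw.symm.trans (hdiag.trans hvand.symm))
    exact inv_injective hij
  have hrow : (Matrix.of fun j k => 1 / (1 - z j * y k)) =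
      Matrix.of fun j k => (∏ m, 1 / (1 - z j * y m)) *
        (Matrix.of fun j k => (p k).eval (z j)) j k := by
    ext j k
    simp only [Matrix.of_apply, hev]
    rw [Fintype.prod_eq_mul_prod_compl k, mul_assoc, ← Finset.prod_mul_distrib,
      Finset.prod_eq_one fun m _ => ?_, mul_one]
    rw [mul_comm (y m), one_div_mul_cancel (hzy j m)]
  rw [hrow, Matrix.det_mul_column, hz, hcy]
  ring

end DividedDifferences

/-! ### The summation formula at generic and at arbitrary points -/

noncomputable section CauchyIdentity

open Polynomial Filter Topology

variable {N : ℕ}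

theorem map_directPoly {R S : Type*} [CommRing R] [CommRing S] (φ : R →+* S) (β : R)
    (l : Fin N → ℕ) (k : Fin N) : (directPoly β l k).map φ = directPoly (φ β) l k := by
  simp [directPoly]

theorem map_dualFamily {R S : Type*} [CommRing R] [CommRing S] (φ : R →+* S) (β : R)
    (l : Fin N → ℕ) (k : Fin N) : (dualFamily β l k).map φ = dualFamily (φ β) l k := by
  simp [dualFamily]

theorem eval_newtonDet_directPoly (β : ℂ) (l : Fin N → ℕ) (z : Fin N → ℂ) :
    MvPolynomial.eval z (newtonDet MvPolynomial.X (directPoly (MvPolynomial.C β) l)) =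
      newtonDet z (directPoly β l) := by
  simp [map_newtonDet, map_directPoly]

theorem eval_newtonDet_dualFamily (β : ℂ) (l : Fin N → ℕ) (y : Fin N → ℂ) :
    MvPolynomial.eval y (newtonDet MvPolynomial.X (dualFamily (MvPolynomial.C β) l)) =
      newtonDet y (dualFamily β l) := by
  simp [map_newtonDet, map_dualFamily]

/-- The strict sup-norm criterion is applied once in each variable; no maximizing index is chosen,
so `N = 0` is covered. -/
theorem norm_mul_lt_one_of_forall {z y : Fin N → ℂ} (h : ∀ j k, ‖z j * y k‖ < 1) :
    ‖z‖ * ‖y‖ < 1 := by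
  have h1 : ∀ k, ‖y k * (‖z‖ : ℂ)‖ < 1 := fun k => by
    have h2 : ‖y k • z‖ < 1 := (pi_norm_lt_iff one_pos).2 fun j => by
      simpa [mul_comm] using h j k
    simpa [norm_smul] using h2
  have h3 : ‖(‖z‖ : ℂ) • y‖ < 1 := (pi_norm_lt_iff one_pos).2 fun k => by
    simpa [mul_comm] using h1 k
  simpa [norm_smul] using h3

theorem norm_apply_mul_apply_lt_one {z y : Fin N → ℂ} (h : ‖z‖ * ‖y‖ < 1) (j k : Fin N) :
    ‖z j * y k‖ < 1 := by
  rw [norm_mul]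
  exact (mul_le_mul (norm_le_pi_norm z _) (norm_le_pi_norm y _) (norm_nonneg _)
    (norm_nonneg _)).trans_lt h

theorem one_sub_ne_zero_of_norm_lt_one {w : ℂ} (h : ‖w‖ < 1) : 1 - w ≠ 0 := by
  intro h0
  rw [← sub_eq_zero.1 h0, norm_one] at h
  exact lt_irrefl _ h

theorem hasSum_newtonDet_of_injective (β : ℂ) {z y : Fin N → ℂ} (h : ‖z‖ * ‖y‖ < 1)
    (hz : Function.Injective z) (hy : Function.Injective y) (hy0 : ∀ k, y k ≠ 0) :
    HasSum (fun l : Partitions N => newtonDet z (directPoly β l.1) * newtonDet y (dualFamily β l.1))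
      ((∏ j, (1 + β * z j) ^ (N - 1)) * ∏ j, ∏ k, 1 / (1 - z j * y k)) := by
  have hVz := Matrix.det_vandermonde_ne_zero_iff.2 hz
  have hVy := Matrix.det_vandermonde_ne_zero_iff.2 hy
  have hsum := (hasSum_det_directPoly_mul_det_dualFamily β z y h).div_const
    ((Matrix.vandermonde z).det * (Matrix.vandermonde y).det)
  have hrow : (Matrix.of fun j k => (1 + β * z j) ^ (N - 1) / (1 - z j * y k)) =
      Matrix.of fun j k => (1 + β * z j) ^ (N - 1) *
        (Matrix.of fun j k => 1 / (1 - z j * y k)) j k := by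
    ext j k
    simp [div_eq_mul_inv]
  rw [hrow, Matrix.det_mul_column, det_one_div_one_sub_mul z y hy hy0 fun j k =>
    one_sub_ne_zero_of_norm_lt_one (norm_apply_mul_apply_lt_one h j k)] at hsum
  have hval : ∀ a b c d : ℂ, b * c ≠ 0 → a * (b * c * d) / (b * c) = a * d := fun a b c d hbc => by
    rw [mul_left_comm, mul_div_cancel_left₀ _ hbc]
  rw [hval _ _ _ _ (mul_ne_zero hVz hVy)] at hsum
  refine Eq.mpr (congrArg (fun f => HasSum f _) (funext fun l => ?_)) hsum
  have h1 : (Matrix.of fun j k => (dualFamily β l.1 j).eval (y k)).det =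
      (Matrix.vandermonde y).det * newtonDet y (dualFamily β l.1) := by
    rw [← det_eval_eq_det_vandermonde_mul, ← Matrix.det_transpose]
    rfl
  rw [h1, det_eval_eq_det_vandermonde_mul]
  field_simp

theorem eventually_add_mul_ne_zero (a : ℂ) {b : ℂ} (hb : b ≠ 0) :
    ∀ᶠ t in 𝓝[≠] (0 : ℂ), a + t * b ≠ 0 := by
  by_cases ha : a = 0
  · filter_upwards [self_mem_nhdsWithin] with t ht
    rw [ha, zero_add]
    exact mul_ne_zero ht hb
  · have h : Tendsto (fun t : ℂ => a + t * b) (𝓝[≠] 0) (𝓝 a) := by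
      have h1 : ContinuousAt (fun t : ℂ => a + t * b) 0 := by fun_prop
      simpa using h1.tendsto.mono_left nhdsWithin_le_nhds
    exact h.eventually_ne ha

/-- A one-parameter perturbation of a point that makes its coordinates distinct and nonzero. -/
def perturb (z : Fin N → ℂ) (t : ℂ) (j : Fin N) : ℂ := z j + t * ((j : ℕ) + 1 : ℂ)

theorem tendsto_perturb (z : Fin N → ℂ) : Tendsto (perturb z) (𝓝[≠] 0) (𝓝 z) := by
  have h : ContinuousAt (perturb z) 0 := by
    refine continuousAt_pi.2 fun j => ?_
    unfold perturb
    fun_prop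
  have h0 : perturb z 0 = z := by
    funext j
    simp [perturb]
  have h1 := h.tendsto
  rw [h0] at h1
  exact h1.mono_left nhdsWithin_le_nhds

theorem eventually_injective_perturb (z : Fin N → ℂ) :
    ∀ᶠ t in 𝓝[≠] (0 : ℂ), Function.Injective (perturb z t) := by
  have h : ∀ i j : Fin N, ∀ᶠ t in 𝓝[≠] (0 : ℂ), perturb z t i = perturb z t j → i = j := by
    intro i j
    by_cases hij : i = j
    · exact Eventually.of_forall fun _ _ => hij
    · have hb : ((i : ℕ) : ℂ) - ((j : ℕ) : ℂ) ≠ 0 := by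
        rw [sub_ne_zero]
        exact fun h => hij (Fin.ext (Nat.cast_injective h))
      filter_upwards [eventually_add_mul_ne_zero (z i - z j) hb] with t ht h
      refine absurd ?_ ht
      simp only [perturb] at h
      linear_combination h
  filter_upwards [eventually_all.2 fun i => eventually_all.2 (h i)] with t ht i j hij
  exact ht i j hij

/-- The slopes in `perturb` are `j + 1` rather than `j` so that the first one is nonzero too. -/
theorem eventually_perturb_ne_zero (z : Fin N → ℂ) :
    ∀ᶠ t in 𝓝[≠] (0 : ℂ), ∀ j, perturb z t j ≠ 0 :=
  eventually_all.2 fun j => eventually_add_mul_ne_zero (z j) (Nat.cast_add_one_ne_zero j)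

theorem hasSum_newtonDet (β : ℂ) {z y : Fin N → ℂ} (h : ‖z‖ * ‖y‖ < 1) :
    HasSum (fun l : Partitions N => newtonDet z (directPoly β l.1) * newtonDet y (dualFamily β l.1))
      ((∏ j, (1 + β * z j) ^ (N - 1)) * ∏ j, ∏ k, 1 / (1 - z j * y k)) := by
  -- Two margins are needed: perturbed nodes stay within `δ` of the norm, and the circles of the
  -- maximum principle have the larger radii with `2 * δ`, whose product must still be below `1`.
  obtain ⟨δ, hδ, hδ1⟩ : ∃ δ : ℝ, 0 < δ ∧ (‖z‖ + 2 * δ) * (‖y‖ + 2 * δ) < 1 := by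
    have hc : ContinuousAt (fun δ : ℝ => (‖z‖ + 2 * δ) * (‖y‖ + 2 * δ)) 0 := by fun_prop
    have h1 : ∀ᶠ δ in 𝓝[>] (0 : ℝ), (‖z‖ + 2 * δ) * (‖y‖ + 2 * δ) < 1 :=
      (hc.eventually_lt continuousAt_const (by simpa using h)).filter_mono nhdsWithin_le_nhds
    obtain ⟨δ, hδ1, hδ⟩ := (h1.and self_mem_nhdsWithin).exists
    exact ⟨δ, hδ, hδ1⟩
  set F : (Fin N → ℂ) → (Fin N → ℂ) → Partitions N → ℂ := fun u v l =>
    newtonDet u (directPoly β l.1) * newtonDet v (dualFamily β l.1) with hF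
  set rz := ‖z‖ + 2 * δ with hrz
  set ry := ‖y‖ + 2 * δ with hry
  have hrz0 : 0 ≤ rz := by positivity
  have hry0 : 0 ≤ ry := by positivity
  set K : ℝ := (N.factorial : ℝ) * (∏ k : Fin N, absEval ((1 + C β * X) ^ (k : ℕ)) rz *
      rz ^ (N - 1 - (k : ℕ)) * (1 + 2 / (rz - (‖z‖ + δ))) ^ N) *
    ((N.factorial : ℝ) * ∏ k : Fin N, absEval ((X + C β) ^ (N - 1 - (k : ℕ))) ry *
      (1 + 2 / (ry - (‖y‖ + δ))) ^ N) with hK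
  have hbound : ∀ u v : Fin N → ℂ, ‖u‖ ≤ ‖z‖ + δ → ‖v‖ ≤ ‖y‖ + δ →
      ∀ l, ‖F u v l‖ ≤ K * ∏ k, (rz * ry) ^ l.1 k := by
    intro u v hu hv l
    have h1 := norm_newtonDet_le u (directPoly β l.1) (r := rz)
      (fun k => absEval ((1 + C β * X) ^ (k : ℕ)) rz * rz ^ (l.1 k + (N - 1 - (k : ℕ))))
      (by positivity) (by linarith) hu fun k w hw => norm_eval_X_pow_mul_le _ hw _
    have h2 := norm_newtonDet_le v (dualFamily β l.1) (r := ry)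
      (fun k => absEval ((X + C β) ^ (N - 1 - (k : ℕ))) ry * ry ^ l.1 k)
      (by positivity) (by linarith) hv fun k w hw => norm_eval_X_pow_mul_le _ hw _
    rw [hF, norm_mul]
    refine (mul_le_mul h1 h2 (norm_nonneg _) ((norm_nonneg _).trans h1)).trans_eq ?_
    simp only [hK, pow_add, mul_pow, Finset.prod_mul_distrib]
    ring
  have hsum : Summable fun l : Partitions N => K * ∏ k, (rz * ry) ^ l.1 k :=
    (summable_prod_pow (mul_nonneg hrz0 hry0) hδ1).mul_left K
  have hz := tendsto_perturb z
  have hy := tendsto_perturb y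
  have hzn : ∀ᶠ t in 𝓝[≠] (0 : ℂ), ‖perturb z t‖ ≤ ‖z‖ + δ :=
    (hz.norm.eventually_lt_const (lt_add_of_pos_right _ hδ)).mono fun _ => le_of_lt
  have hyn : ∀ᶠ t in 𝓝[≠] (0 : ℂ), ‖perturb y t‖ ≤ ‖y‖ + δ :=
    (hy.norm.eventually_lt_const (lt_add_of_pos_right _ hδ)).mono fun _ => le_of_lt
  have hlim : ∀ l, Tendsto (fun t => F (perturb z t) (perturb y t) l) (𝓝[≠] 0) (𝓝 (F z y l)) := by
    intro l
    -- Each term is a value of multivariate polynomials, hence continuous even where nodes collide.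
    simp only [hF, ← eval_newtonDet_directPoly, ← eval_newtonDet_dualFamily]
    exact (((MvPolynomial.continuous_eval _).tendsto z).comp hz).mul
      (((MvPolynomial.continuous_eval _).tendsto y).comp hy)
  have ht := tendsto_tsum_of_dominated_convergence hsum hlim <| by
    filter_upwards [hzn, hyn] with t h1 h2
    exact hbound _ _ h1 h2
  have hgen : ∀ᶠ t in 𝓝[≠] (0 : ℂ), ∑' l, F (perturb z t) (perturb y t) l =
      (∏ j, (1 + β * perturb z t j) ^ (N - 1)) *
        ∏ j, ∏ k, 1 / (1 - perturb z t j * perturb y t k) := by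
    filter_upwards [hzn, hyn, eventually_injective_perturb z, eventually_injective_perturb y,
      eventually_perturb_ne_zero y] with t h1 h2 h3 h4 h5
    refine (hasSum_newtonDet_of_injective β (lt_of_le_of_lt ?_ hδ1) h3 h4 h5).tsum_eq
    exact mul_le_mul (by linarith) (by linarith) (norm_nonneg _) hrz0
  have hzj := fun j => (tendsto_pi_nhds.1 hz) j
  have hyk := fun k => (tendsto_pi_nhds.1 hy) k
  have hR : Tendsto (fun t => (∏ j, (1 + β * perturb z t j) ^ (N - 1)) *
      ∏ j, ∏ k, 1 / (1 - perturb z t j * perturb y t k)) (𝓝[≠] 0)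
      (𝓝 ((∏ j, (1 + β * z j) ^ (N - 1)) * ∏ j, ∏ k, 1 / (1 - z j * y k))) := by
    refine Tendsto.mul (tendsto_finsetProd _ fun j _ => ?_)
      (tendsto_finsetProd _ fun j _ => tendsto_finsetProd _ fun k _ => ?_)
    · exact (((hzj j).const_mul β).const_add 1).pow _
    · exact tendsto_const_nhds.div (((hzj j).mul (hyk k)).const_sub 1)
        (one_sub_ne_zero_of_norm_lt_one (norm_apply_mul_apply_lt_one h j k))
  rw [← tendsto_nhds_unique (ht.congr' hgen) hR]
  refine (Summable.of_norm_bounded hsum fun l => hbound z y ?_ ?_ l).hasSum <;> linarith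

end CauchyIdentity

/-! ### Translation to reduced rational functions -/

noncomputable section RationalFunctions

open Polynomial

variable {N : ℕ}

theorem algebraMap_ratField_injective :
    Function.Injective (algebraMap (MvPolynomial (Fin N) ℂ) (RatField N)) :=
  IsFractionRing.injective _ _

theorem ratEval_algebraMap (a : Fin N → ℂ) (p : MvPolynomial (Fin N) ℂ) :
    ratEval a (algebraMap _ (RatField N) p) = MvPolynomial.eval a p := by
  simpa using ratEval_div a p 1 (by simp)

/-- The sign relating `∏_{j < k} (z_j - z_k)` and `∏_{j < k} (z_k - z_j)`. -/
def vandermondeSign (N : ℕ) : ℤ := ∏ i : Fin N, ∏ _j ∈ Finset.Ioi i, (-1)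

theorem vandermondeSign_mul_self (N : ℕ) : vandermondeSign N * vandermondeSign N = 1 := by
  simp [vandermondeSign, ← Finset.prod_mul_distrib, ← mul_pow]

theorem vandermondeProd_eq :
    vandermondeProd N = vandermondeSign N * algebraMap (MvPolynomial (Fin N) ℂ) (RatField N)
      (Matrix.vandermonde MvPolynomial.X).det := by
  simp only [vandermondeProd, vandermondeSign, Matrix.det_vandermonde, ratVar, map_prod, map_sub,
    Int.cast_prod, ← Finset.prod_mul_distrib]
  refine Finset.prod_congr rfl fun i _ => Finset.prod_congr rfl fun j _ => ?_
  push_cast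
  ring

theorem algebraMap_det_vandermonde_ne_zero :
    algebraMap (MvPolynomial (Fin N) ℂ) (RatField N)
      (Matrix.vandermonde MvPolynomial.X).det ≠ 0 := by
  rw [Ne, map_eq_zero_iff _ algebraMap_ratField_injective]
  exact Matrix.det_vandermonde_ne_zero_iff.2 (MvPolynomial.X_injective)

theorem vandermondeSign_cast_mul_self :
    (vandermondeSign N : RatField N) * vandermondeSign N = 1 := by
  exact_mod_cast congrArg (Int.cast : ℤ → RatField N) (vandermondeSign_mul_self N)

theorem algebraMap_mul_div_vandermondeProd (c : RatField N) (p : MvPolynomial (Fin N) ℂ) :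
    c * algebraMap (MvPolynomial (Fin N) ℂ) (RatField N)
        ((Matrix.vandermonde MvPolynomial.X).det * p) / vandermondeProd N =
      c * algebraMap (MvPolynomial (Fin N) ℂ) (RatField N) (vandermondeSign N * p) := by
  have hs := vandermondeSign_cast_mul_self (N := N)
  have hs0 : (vandermondeSign N : RatField N) ≠ 0 := left_ne_zero_of_mul_eq_one hs
  rw [vandermondeProd_eq, div_eq_iff (mul_ne_zero hs0 algebraMap_det_vandermonde_ne_zero),
    map_mul, map_mul, map_intCast]
  linear_combination (-c * algebraMap (MvPolynomial (Fin N) ℂ) (RatField N)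
    (Matrix.vandermonde MvPolynomial.X).det * algebraMap (MvPolynomial (Fin N) ℂ) (RatField N) p)
      * hs

/-- The Vandermonde factor cancels in the polynomial ring, so evaluation is legitimate at every
point. -/
theorem grothendieck_eq (β : ℂ) (l : Partitions N) :
    grothendieck β l = algebraMap (MvPolynomial (Fin N) ℂ) (RatField N)
      (vandermondeSign N * newtonDet MvPolynomial.X (directPoly (MvPolynomial.C β) l.1)) := by
  have h := algebraMap_mul_div_vandermondeProd 1
    (newtonDet MvPolynomial.X (directPoly (MvPolynomial.C β) l.1))
  rw [one_mul, one_mul, ← det_eval_eq_det_vandermonde_mul, RingHom.map_det] at h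
  rw [← h, grothendieck]
  congr 2
  ext j k
  simp [directPoly, ratVar, ratConst]

theorem ratEval_grothendieck (β : ℂ) (l : Partitions N) (z : Fin N → ℂ) :
    ratEval z (grothendieck β l) = vandermondeSign N * newtonDet z (directPoly β l.1) := by
  rw [grothendieck_eq, ratEval_algebraMap, map_mul, map_intCast, eval_newtonDet_directPoly]

/-- The factor pulled out does not depend on the column `k`, so it leaves the determinant as a row
factor. -/
theorem pow_mul_one_add_mul_inv_zpow {F : Type*} [Field F] {x b : F} (hx : x ≠ 0)
    (hxb : x + b ≠ 0) (m : ℕ) (k : Fin N) :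
    x ^ (m + (N - 1 - (k : ℕ))) * (1 + b * x⁻¹) ^ (-((k : ℕ) : ℤ)) =
      (x ^ (N - 1) / (x + b) ^ (N - 1)) * (x ^ m * (x + b) ^ (N - 1 - (k : ℕ))) := by
  have h1 : N - 1 = (N - 1 - (k : ℕ)) + k := by omega
  have h2 : 1 + b * x⁻¹ = (x + b) / x := by field_simp
  rw [h2, zpow_neg, zpow_natCast]
  generalize N - 1 - (k : ℕ) = n at h1
  rw [h1, pow_add, pow_add, pow_add, div_pow]
  field_simp

theorem dualGrothendieck_eq (β : ℂ) (l : Partitions N) :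
    dualGrothendieck β l =
      algebraMap (MvPolynomial (Fin N) ℂ) (RatField N)
        ((∏ j, MvPolynomial.X j ^ (N - 1)) *
          ((vandermondeSign N : MvPolynomial (Fin N) ℂ) *
            newtonDet MvPolynomial.X (dualFamily (MvPolynomial.C β) l.1))) /
      algebraMap (MvPolynomial (Fin N) ℂ) (RatField N)
        (∏ j, (MvPolynomial.X j + MvPolynomial.C β) ^ (N - 1)) := by
  set c : RatField N := ∏ j : Fin N,
    (ratVar j ^ (N - 1) / (ratVar j + ratConst β) ^ (N - 1)) with hc
  have hX : ∀ j : Fin N, (ratVar j : RatField N) ≠ 0 := fun j => by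
    rw [ratVar, Ne, map_eq_zero_iff _ algebraMap_ratField_injective]
    exact MvPolynomial.X_ne_zero j
  have hXb : ∀ j : Fin N, (ratVar j + ratConst β : RatField N) ≠ 0 := fun j => by
    rw [ratVar, ratConst, ← map_add, Ne, map_eq_zero_iff _ algebraMap_ratField_injective]
    intro h0
    -- At this point the polynomial takes the value `1`.
    have h1 := congrArg (MvPolynomial.eval fun _ => 1 - β) h0
    simp at h1
  have hmat : (Matrix.of fun j k : Fin N => ratVar j ^ (l.1 k + (N - 1 - (k : ℕ))) *
      (1 + ratConst β * (ratVar j)⁻¹) ^ (-((k : ℕ) : ℤ))) =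
      Matrix.of fun j k : Fin N => (ratVar j ^ (N - 1) / (ratVar j + ratConst β) ^ (N - 1)) *
        ((algebraMap (MvPolynomial (Fin N) ℂ) (RatField N)).mapMatrix
          (Matrix.of fun j k : Fin N =>
            (dualFamily (MvPolynomial.C β) l.1 k).eval (MvPolynomial.X j))) j k := by
    ext j k
    rw [Matrix.of_apply, Matrix.of_apply, pow_mul_one_add_mul_inv_zpow (hX j) (hXb j)]
    simp [dualFamily, ratVar, ratConst]
  rw [dualGrothendieck, hmat, Matrix.det_mul_column, ← RingHom.map_det,
    det_eval_eq_det_vandermonde_mul, algebraMap_mul_div_vandermondeProd, Finset.prod_div_distrib,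
    map_mul _ (∏ j, _), map_prod, map_prod, div_mul_eq_mul_div]
  simp [ratVar, ratConst]

theorem ratEval_dualGrothendieck (β : ℂ) (l : Partitions N) (y : Fin N → ℂ)
    (hy : ∀ j, y j + β ≠ 0) :
    ratEval y (dualGrothendieck β l) =
      (∏ j, (y j / (y j + β)) ^ (N - 1)) *
        (vandermondeSign N * newtonDet y (dualFamily β l.1)) := by
  have h0 : MvPolynomial.eval y (∏ j, (MvPolynomial.X j + MvPolynomial.C β) ^ (N - 1)) ≠ 0 := by
    rw [map_prod]
    refine Finset.prod_ne_zero_iff.2 fun j _ => ?_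
    simpa using pow_ne_zero (N - 1) (hy j)
  rw [dualGrothendieck_eq, ratEval_div y _ _ h0]
  simp [eval_newtonDet_dualFamily, div_pow, Finset.prod_div_distrib, mul_div_right_comm]

theorem grothendieck_zero (l : Partitions N) : grothendieck 0 l = schurPoly l := by
  simp [grothendieck, schurPoly, ratConst]

theorem dualGrothendieck_zero (l : Partitions N) : dualGrothendieck 0 l = schurPoly l := by
  simp [dualGrothendieck, schurPoly, ratConst]

/-- At `β = 0` the direct and dual polynomials coincide. Using `grothendieck` instead of
`dualGrothendieck` allows zero coordinates of `y`. -/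
theorem ratEval_schurPoly_eq_newtonDet_dualFamily (l : Partitions N) (y : Fin N → ℂ) :
    ratEval y (schurPoly l) = vandermondeSign N * newtonDet y (dualFamily 0 l.1) := by
  rw [← grothendieck_zero, ratEval_grothendieck]
  congr 2
  funext k
  simp [directPoly, dualFamily, pow_add]

end RationalFunctions

/-! ### The Cauchy identities -/

theorem mainTheorem7 (N : ℕ) :
    (∀ (β : ℂ) (z y : Fin N → ℂ),
      (∀ j, y j ≠ 0) → (∀ j, 1 + β * (y j)⁻¹ ≠ 0) → (∀ j k, ‖z j * y k‖ < 1) →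
      HasSum
        (fun l : Partitions N => ratEval z (grothendieck β l) * ratEval y (dualGrothendieck β l))
        ((∏ j, ((1 + β * z j) / (1 + β * (y j)⁻¹)) ^ (N - 1)) *
          ∏ j, ∏ k, 1 / (1 - z j * y k))) ∧
    (∀ l : Partitions N, grothendieck 0 l = schurPoly l ∧ dualGrothendieck 0 l = schurPoly l) ∧
    (∀ z y : Fin N → ℂ, (∀ j k, ‖z j * y k‖ < 1) →
      HasSum (fun l : Partitions N => ratEval z (schurPoly l) * ratEval y (schurPoly l))
        (∏ j, ∏ k, 1 / (1 - z j * y k))) := by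
  -- The orientation signs of the two Vandermonde products cancel in each summand.
  have hs : (vandermondeSign N : ℂ) * vandermondeSign N = 1 := by
    exact_mod_cast congrArg (Int.cast : ℤ → ℂ) (vandermondeSign_mul_self N)
  refine ⟨fun β z y hy hyb hzy => ?_,
    fun l => ⟨grothendieck_zero l, dualGrothendieck_zero l⟩, fun z y hzy => ?_⟩
  · have hsplit : ∀ j, 1 + β * (y j)⁻¹ = (y j + β) / y j := fun j => by
      have := hy j
      field_simp
    have hyb' : ∀ j, y j + β ≠ 0 := fun j h0 => hyb j (by rw [hsplit, h0, zero_div])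
    have h := (hasSum_newtonDet β (norm_mul_lt_one_of_forall hzy)).mul_left
      (∏ j, (y j / (y j + β)) ^ (N - 1))
    have hval : (∏ j, ((1 + β * z j) / (1 + β * (y j)⁻¹)) ^ (N - 1)) =
        (∏ j, (y j / (y j + β)) ^ (N - 1)) * ∏ j, (1 + β * z j) ^ (N - 1) := by
      rw [← Finset.prod_mul_distrib]
      refine Finset.prod_congr rfl fun j _ => ?_
      rw [hsplit, div_div_eq_mul_div, ← mul_pow]
      congr 1
      ring
    rw [hval, mul_assoc]
    refine Eq.mpr (congrArg (fun f => HasSum f _) (funext fun l => ?_)) h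
    rw [ratEval_grothendieck, ratEval_dualGrothendieck β l y hyb']
    linear_combination ((∏ j, (y j / (y j + β)) ^ (N - 1)) *
      newtonDet z (directPoly β l.1) * newtonDet y (dualFamily β l.1)) * hs
  · have h := hasSum_newtonDet 0 (norm_mul_lt_one_of_forall hzy)
    simp only [zero_mul, add_zero, one_pow, Finset.prod_const_one, one_mul] at h
    refine Eq.mpr (congrArg (fun f => HasSum f _) (funext fun l => ?_)) h
    rw [ratEval_schurPoly_eq_newtonDet_dualFamily l y, ← grothendieck_zero, ratEval_grothendieck]
    linear_combination (newtonDet z (directPoly 0 l.1) * newtonDet y (dualFamily 0 l.1)) * hs
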